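/- Let $n,r\ge 0$, let $M,D\in\mathbb C^{n\times n}$ be Hermitian with $M$ positive definite and $D$ positive semidefinite, and let $G\in\mathbb C^{n\times r}$ have rank $r$. Put $$P(\lambda)=\lambda^2M+\lambda D+GG^*,\qquad T(\lambda)=\frac{P(\lambda)}{\lambda},\qquad S(\lambda)=\begin{bmatrix}\lambda M+D & G\\ G^* & -\lambda I_r\end{bmatrix}.$$ For a square polynomial matrix $A$ let $\Lambda(A)=\{\lambda\in\mathbb C:\det A(\lambda)=0\}$. The Smith form of a regular ($\det A\not\equiv0$) $m\times m$ polynomial matrix $A$ is the unique matrix $\mathrm{diag}(\theta_1,\dots,\theta_m)$ with monic polynomials $\theta_1\mid\theta_2\mid\cdots\mid\theta_m$ that is equal to $UAV$ for some unimodular polynomial matrices $U,V$; the multiplicity index of $\mu\in\mathbb C$ is $\mathrm{Ind}(\mu,A)=(k_1,\dots,k_m)$, where $k_i$ is the multiplicity of $\mu$ as a root of $\theta_i$ (the nonzero $k_i$ are the partial multiplicities of $\mu$). The Smith–McMillan form of a regular rational $n\times n$ matrix $T$ is the matrix $\mathrm{diag}(\phi_1/\psi_1,\dots,\phi_n/\psi_n)=UTV$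 with $U,V$ unimodular polynomial matrices and $\phi_i,\psi_i$ monic polynomials such that $\phi_i,\psi_i$ are coprime for each $i$, $\phi_i\mid\phi_{i+1}$ and $\psi_{i+1}\mid\psi_i$. Then: 1. $T$ has a Smith–McMillan form, and if it is $\mathrm{diag}(\phi_1/\psi_1,\dots,\phi_n/\psi_n)$, then the Smith form of $S$ is $$\begin{bmatrix} I_r & \\ & \mathrm{diag}(\phi_1,\dots,\phi_n)\end{bmatrix}.$$ 2. $\Lambda(S)\setminus\{0\}=\Lambda(P)\setminus\{0\}$, and for every $\mu\in\Lambda(P)\setminus\{0\}$ the multiplicity indices $\mathrm{Ind}(\mu,P)$ and $\mathrm{Ind}(\mu,S)$ exist, are unique, and agree up to leading zeros: if $\mathrm{Ind}(\mu,P)=(k_1,\dots,k_n)$, then $\mathrm{Ind}(\mu,S)=(0,\dots,0,k_1,\dots,k_n)$ with $r$ leading zeros. In particular $\mu$ has the same partial multiplicities for $S$ and for $P$. 3. For every $\lambda_0\in\mathbb C\setminus\{0\}$ the map $$\mathcal N(P(\lambda_0))\to\mathcal N(S(\lambda_0)),\qquad u\mapsto\begin{bmatrix}\lambda_0u\\ G^*u\end{bmatrix},$$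 between null spaces is a (well-defined) linear isomorphism. 4. If $D$ is invertible, then $0\in\Lambda(S)$ if and only if $G^*D^{-1}G$ is singular. 5. If $D$ is positive definite, then $\Lambda(S)=\Lambda(P)\setminus\{0\}$. -/

import Mathlib

open Polynomial
open scoped Matrix ComplexOrder

noncomputable section

/-- The complex matrix `A(z)` obtained by evaluating a polynomial matrix at `z`. -/
def evalMatrix {ι κ : Type*} (A : Matrix ι κ ℂ[X]) (z : ℂ) : Matrix ι κ ℂ :=
  A.map (Polynomial.eval z)

/-- The spectrum `Λ(A)`: all `z` with `det A(z) = 0`. -/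
def polySpectrum {ι : Type*} [Fintype ι] [DecidableEq ι] (A : Matrix ι ι ℂ[X]) : Set ℂ :=
  {z | (evalMatrix A z).det = 0}

/-- The null space of a complex matrix. -/
def nullSpace {ι κ : Type*} [Fintype κ] (A : Matrix ι κ ℂ) : Submodule ℂ (κ → ℂ) :=
  LinearMap.ker A.mulVecLin

/-- `diag(φ₀, …, φₘ₋₁)` is the Smith form of the regular square polynomial matrix `A`: the `φᵢ` are
monic, each divides the next ones, and `A` is unimodularly equivalent to the diagonal matrix.
The rows and columns of `A` are numbered by some bijection `e` of the index set with `Fin m`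
(changing `e` only multiplies by permutation matrices, which are unimodular). -/
def IsSmithForm {ι : Type*} {m : ℕ} (A : Matrix ι ι ℂ[X]) (φ : Fin m → ℂ[X]) : Prop :=
  (∀ i, (φ i).Monic) ∧
  (∀ i j, i ≤ j → φ i ∣ φ j) ∧
  ∃ (e : ι ≃ Fin m) (U V : Matrix (Fin m) (Fin m) ℂ[X]), IsUnit U ∧ IsUnit V ∧
    U * Matrix.reindex e e A * V = Matrix.diagonal φ

/-- `diag(φ₀/ψ₀, …, φₘ₋₁/ψₘ₋₁)` is the Smith–McMillan form of the regular rational matrix `T`. -/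
def IsSmithMcMillanForm {m : ℕ} (T : Matrix (Fin m) (Fin m) (RatFunc ℂ))
    (φ ψ : Fin m → ℂ[X]) : Prop :=
  (∀ i, (φ i).Monic) ∧ (∀ i, (ψ i).Monic) ∧
  (∀ i, IsCoprime (φ i) (ψ i)) ∧
  (∀ i j, i ≤ j → φ i ∣ φ j) ∧
  (∀ i j, i ≤ j → ψ j ∣ ψ i) ∧
  ∃ U V : Matrix (Fin m) (Fin m) ℂ[X], IsUnit U ∧ IsUnit V ∧
    U.map (algebraMap ℂ[X] (RatFunc ℂ)) * T * V.map (algebraMap ℂ[X] (RatFunc ℂ)) =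
      Matrix.diagonal fun i =>
        algebraMap ℂ[X] (RatFunc ℂ) (φ i) / algebraMap ℂ[X] (RatFunc ℂ) (ψ i)

/-- `k` is the multiplicity index `Ind(μ, A)`: `kᵢ` is the multiplicity of `μ` as a root of the
`i`-th diagonal entry of the Smith form of `A`. -/
def IsMultiplicityIndex {ι : Type*} {m : ℕ} (μ : ℂ) (A : Matrix ι ι ℂ[X])
    (k : Fin m → ℕ) : Prop :=
  ∃ φ : Fin m → ℂ[X], IsSmithForm A φ ∧ ∀ i, k i = (φ i).rootMultiplicity μ

/-- `P(λ) = λ² M + λ D + G G*`. -/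
def quadP {n r : ℕ} (M D : Matrix (Fin n) (Fin n) ℂ) (G : Matrix (Fin n) (Fin r) ℂ) :
    Matrix (Fin n) (Fin n) ℂ[X] :=
  (X ^ 2 : ℂ[X]) • M.map C + (X : ℂ[X]) • D.map C + (G * Gᴴ).map C

/-- `T(λ) = P(λ) / λ`. -/
def ratT {n r : ℕ} (M D : Matrix (Fin n) (Fin n) ℂ) (G : Matrix (Fin n) (Fin r) ℂ) :
    Matrix (Fin n) (Fin n) (RatFunc ℂ) :=
  (RatFunc.X : RatFunc ℂ)⁻¹ • (quadP M D G).map (algebraMap ℂ[X] (RatFunc ℂ))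

/-- `S(λ) = [λ M + D, G; G*, -λ I_r]`. -/
def pencilS {n r : ℕ} (M D : Matrix (Fin n) (Fin n) ℂ) (G : Matrix (Fin n) (Fin r) ℂ) :
    Matrix (Fin n ⊕ Fin r) (Fin n ⊕ Fin r) ℂ[X] :=
  Matrix.fromBlocks ((X : ℂ[X]) • M.map C + D.map C) (G.map C)
    (Gᴴ.map C) (-((X : ℂ[X]) • (1 : Matrix (Fin r) (Fin r) ℂ[X])))

end

/-!
# Smith forms of a damped system and of its linearization

The Smith form of a square polynomial matrix over a field exists because an entry of least degree
in an equivalence class divides all other entries (`exists_unimodularEquivalent_dvd`) and can be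
split off. It is unique because in `U * diag φ = diag χ * V` a prime power dividing `φ i` but not
`χ i` would force a prime to divide a block of `V` so large that `det V` is divisible by it
(`pow_dvd_of_mul_diagonal_eq`).

Let `U * P * V = diag p`. Since `P = X • (X • M + D) + G Gᴴ`, evaluation at zero gives
`U(0) G Gᴴ V(0) = diag c` with `c i = p i (0)`. As `G` has full column rank `r`, exactly `r` of the
`c i` are nonzero, and, with `J` the matrix whose columns are the corresponding unit vectors,
`U(0) G = J E` and `Gᴴ V(0) = F Jᵀ` (`exists_selection_of_mul_mul_eq_diagonal`). Modulo `X` the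
off-diagonal blocks of `S` can thus be reduced to `J` and `Jᵀ diag c`, and their remaining parts,
being multiples of `X`, are eliminated with the block `-X • 1`. The leading block then
becomes `(diag p - diag c) / X`, and one more elimination leaves `diag φ ⊕ 1`, where `φ i` is
`p i / X` if `X ∣ p i` and `p i` otherwise (`pencilS_unimodularEquivalent`). These `φ i` are the
numerators of the Smith–McMillan form of `T = P / X`, because a denominator `ψ i` must divide `X`
(`IsSmithMcMillanForm.exists_unimodularEquivalent_quadP`). At `μ ≠ 0` a factor `X` does not matter,
which gives the multiplicity indices.

The isomorphism of null spaces is the elimination of the second block row of `S(z)`, and the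
eigenvalue zero is decided by the Schur complement of `D` in `S(0)`.
-/

/-! ### Unimodular equivalence -/

/-- Two square matrices over a ring, possibly with different index types, are unimodularly
equivalent if `U * A * V = B` for invertible `U` and `V`. As the index types may differ, `U` and
`V` are rectangular in form, and their invertibility is expressed by two-sided inverses. -/
def UnimodularEquivalent {R ι κ : Type*} [CommRing R] [Fintype ι] [DecidableEq ι]
    [Fintype κ] [DecidableEq κ] (A : Matrix ι ι R) (B : Matrix κ κ R) : Prop :=
  ∃ (U : Matrix κ ι R) (U' : Matrix ι κ R) (V : Matrix ι κ R) (V' : Matrix κ ι R),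
    U * U' = 1 ∧ U' * U = 1 ∧ V * V' = 1 ∧ V' * V = 1 ∧ U * A * V = B

namespace UnimodularEquivalent

variable {R ι κ τ : Type*} [CommRing R] [Fintype ι] [DecidableEq ι] [Fintype κ] [DecidableEq κ]
  [Fintype τ] [DecidableEq τ]

theorem symm {A : Matrix ι ι R} {B : Matrix κ κ R} (h : UnimodularEquivalent A B) :
    UnimodularEquivalent B A := by
  obtain ⟨U, U', V, V', h₁, h₂, h₃, h₄, rfl⟩ := h
  refine ⟨U', U, V', V, h₂, h₁, h₄, h₃, ?_⟩
  calc U' * (U * A * V) * V' = (U' * U) * A * (V * V') := by simp only [Matrix.mul_assoc]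
    _ = A := by rw [h₂, h₃, Matrix.one_mul, Matrix.mul_one]

theorem trans {A : Matrix ι ι R} {B : Matrix κ κ R} {C : Matrix τ τ R}
    (h : UnimodularEquivalent A B) (h' : UnimodularEquivalent B C) :
    UnimodularEquivalent A C := by
  obtain ⟨U, U', V, V', h₁, h₂, h₃, h₄, rfl⟩ := h
  obtain ⟨W, W', Z, Z', k₁, k₂, k₃, k₄, rfl⟩ := h'
  refine ⟨W * U, U' * W', V * Z, Z' * V', ?_, ?_, ?_, ?_, ?_⟩
  · rw [Matrix.mul_assoc, ← Matrix.mul_assoc U, h₁, Matrix.one_mul, k₁]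
  · rw [Matrix.mul_assoc, ← Matrix.mul_assoc W', k₂, Matrix.one_mul, h₂]
  · rw [Matrix.mul_assoc, ← Matrix.mul_assoc Z, k₃, Matrix.one_mul, h₃]
  · rw [Matrix.mul_assoc, ← Matrix.mul_assoc V', h₄, Matrix.one_mul, k₄]
  · simp only [Matrix.mul_assoc]

theorem of_isUnit {A B U V : Matrix ι ι R} (hU : IsUnit U) (hV : IsUnit V)
    (h : U * A * V = B) : UnimodularEquivalent A B := by
  obtain ⟨U, rfl⟩ := hU
  obtain ⟨V, rfl⟩ := hV
  exact ⟨U, ↑U⁻¹, V, ↑V⁻¹, U.mul_inv, U.inv_mul, V.mul_inv, V.inv_mul, h⟩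

theorem refl (A : Matrix ι ι R) : UnimodularEquivalent A A :=
  of_isUnit isUnit_one isUnit_one (by simp)

/-- Rows and columns may be renumbered independently. -/
theorem submatrix (A : Matrix ι ι R) (e f : κ ≃ ι) :
    UnimodularEquivalent A (A.submatrix e f) := by
  refine ⟨(1 : Matrix ι ι R).submatrix e id, (1 : Matrix ι ι R).submatrix id e,
    (1 : Matrix ι ι R).submatrix id f, (1 : Matrix ι ι R).submatrix f id, ?_, ?_, ?_, ?_, ?_⟩
  · ext i j; simp [Matrix.mul_apply, Matrix.one_apply]
  · rw [Matrix.submatrix_mul_equiv]; simp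
  · rw [Matrix.submatrix_mul_equiv]; simp
  · ext i j; simp [Matrix.mul_apply, Matrix.one_apply]
  · ext i j; simp [Matrix.mul_apply, Matrix.one_apply]

theorem mul_left {A U : Matrix ι ι R} (hU : IsUnit U) : UnimodularEquivalent A (U * A) :=
  of_isUnit hU isUnit_one (by simp)

theorem mul_right {A V : Matrix ι ι R} (hV : IsUnit V) : UnimodularEquivalent A (A * V) :=
  of_isUnit isUnit_one hV (by simp)

theorem smul {A : Matrix ι ι R} {B : Matrix κ κ R} (h : UnimodularEquivalent A B) (c : R) :
    UnimodularEquivalent (c • A) (c • B) := by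
  obtain ⟨U, U', V, V', h₁, h₂, h₃, h₄, rfl⟩ := h
  exact ⟨U, U', V, V', h₁, h₂, h₃, h₄, by simp⟩

theorem fromBlocks_one {A : Matrix ι ι R} {B : Matrix κ κ R} (h : UnimodularEquivalent A B) :
    UnimodularEquivalent (Matrix.fromBlocks (1 : Matrix τ τ R) 0 0 A)
      (Matrix.fromBlocks (1 : Matrix τ τ R) 0 0 B) := by
  obtain ⟨U, U', V, V', h₁, h₂, h₃, h₄, rfl⟩ := h
  refine ⟨Matrix.fromBlocks 1 0 0 U, Matrix.fromBlocks 1 0 0 U', Matrix.fromBlocks 1 0 0 V,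
    Matrix.fromBlocks 1 0 0 V', ?_, ?_, ?_, ?_, ?_⟩ <;>
  simp [Matrix.fromBlocks_multiply, *]

theorem exists_isUnit {A B : Matrix ι ι R} (h : UnimodularEquivalent A B) :
    ∃ U V : Matrix ι ι R, IsUnit U ∧ IsUnit V ∧ U * A * V = B := by
  obtain ⟨U, U', V, V', h₁, h₂, h₃, h₄, rfl⟩ := h
  exact ⟨U, V, ⟨⟨U, U', h₁, h₂⟩, rfl⟩, ⟨⟨V, V', h₃, h₄⟩, rfl⟩, rfl⟩

end UnimodularEquivalent

/-- The numbering of the index set in `IsSmithForm` may be absorbed into the unimodular factors. -/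
theorem isSmithForm_iff {ι : Type*} [Fintype ι] [DecidableEq ι] {m : ℕ} (e : ι ≃ Fin m)
    (A : Matrix ι ι ℂ[X]) (φ : Fin m → ℂ[X]) :
    IsSmithForm A φ ↔ (∀ i, (φ i).Monic) ∧ (∀ i j, i ≤ j → φ i ∣ φ j) ∧
      UnimodularEquivalent A (Matrix.diagonal φ) := by
  refine and_congr_right fun _ => and_congr_right fun _ => ⟨?_, fun h => ?_⟩
  · rintro ⟨e', U, V, hU, hV, h⟩
    exact (UnimodularEquivalent.submatrix A e'.symm e'.symm).trans (.of_isUnit hU hV h)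
  · exact ⟨e, ((UnimodularEquivalent.submatrix A e.symm e.symm).symm.trans h).exists_isUnit⟩

/-! ### Uniqueness of the Smith form -/

/-- A square matrix with an `(i + 1) × (m - i)` block divisible by `p` has determinant divisible
by `p`: by the pigeonhole principle every permutation meets the block. -/
theorem dvd_det_of_dvd_block {R : Type*} [CommRing R] {m : ℕ} (V : Matrix (Fin m) (Fin m) R)
    (p : R) (i : Fin m) (h : ∀ a b, a ≤ i → i ≤ b → p ∣ V a b) : p ∣ V.det := by
  rw [← Matrix.det_transpose, Matrix.det_apply]
  refine Finset.dvd_sum fun σ _ => ?_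
  rw [Units.smul_def, zsmul_eq_mul]
  refine Dvd.dvd.mul_left ?_ _
  obtain ⟨a, ha, hb⟩ : ∃ a, a ≤ i ∧ i ≤ σ a := by
    by_contra! hcon
    have := Finset.card_le_card_of_injOn (s := Finset.Iic i) (t := Finset.Iio i) σ
      (fun a ha => by simpa using hcon a (by simpa using ha)) σ.injective.injOn
    simp at this
  exact (h a (σ a) ha hb).trans (Finset.dvd_prod_of_mem (fun a => Vᵀ (σ a) a) (Finset.mem_univ a))

/-- The local form of the uniqueness of the Smith form. If `p ^ k` divides `φ i` but not `χ i`,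
comparing the entries of `U * diag φ = diag χ * V` shows that `p` divides the entries `V a b` with
`a ≤ i ≤ b`, hence the determinant of the invertible matrix `V`. -/
theorem pow_dvd_of_mul_diagonal_eq {R : Type*} [CommRing R] [IsDomain R] {m : ℕ}
    {φ χ : Fin m → R} (hφ : ∀ i j, i ≤ j → φ i ∣ φ j) (hχ : ∀ i j, i ≤ j → χ i ∣ χ j)
    {U V : Matrix (Fin m) (Fin m) R} (hV : IsUnit V)
    (h : U * Matrix.diagonal φ = Matrix.diagonal χ * V) {p : R} (hp : Prime p) (k : ℕ)
    (i : Fin m) (hk : p ^ k ∣ φ i) : p ^ k ∣ χ i := by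
  by_contra hcon
  refine hp.not_isUnit (isUnit_of_dvd_unit (dvd_det_of_dvd_block V p i fun a b ha hb => ?_)
    ((Matrix.isUnit_iff_isUnit_det V).1 hV))
  by_contra hab
  refine hcon ((hp.pow_dvd_of_dvd_mul_right k hab ?_).trans (hχ a i ha))
  have := congrFun (congrFun h a) b
  rw [Matrix.mul_diagonal, Matrix.diagonal_mul] at this
  exact this ▸ (hk.trans (hφ i b hb)).mul_left _

theorem dvd_of_unimodularEquivalent_diagonal {R : Type*} [CommRing R] [IsDomain R]
    [UniqueFactorizationMonoid R] {m : ℕ} {φ χ : Fin m → R} (hφ : ∀ i j, i ≤ j → φ i ∣ φ j)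
    (hχ : ∀ i j, i ≤ j → χ i ∣ χ j) (hφ₀ : ∀ i, φ i ≠ 0)
    (h : UnimodularEquivalent (Matrix.diagonal φ) (Matrix.diagonal χ)) (i : Fin m) :
    φ i ∣ χ i := by
  obtain ⟨U, V, hU, hV, h⟩ := h.exists_isUnit
  obtain ⟨V, rfl⟩ := hV
  have h' : U * Matrix.diagonal φ = Matrix.diagonal χ * (↑V⁻¹ : Matrix (Fin m) (Fin m) R) := by
    rw [← h, Matrix.mul_assoc, Units.mul_inv, Matrix.mul_one]
  rw [UniqueFactorizationMonoid.dvd_iff_emultiplicity_le (hφ₀ i)]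
  intro p hp
  exact emultiplicity_le_emultiplicity_iff.2 fun k hk =>
    pow_dvd_of_mul_diagonal_eq hφ hχ (Units.isUnit _) h' hp k i hk

theorem IsSmithForm.unique {ι : Type*} [Fintype ι] [DecidableEq ι] {m : ℕ}
    {A : Matrix ι ι ℂ[X]} {φ χ : Fin m → ℂ[X]} (hφ : IsSmithForm A φ) (hχ : IsSmithForm A χ) :
    φ = χ := by
  obtain ⟨e, -⟩ := hφ.2.2
  obtain ⟨h₁, h₂, h₃⟩ := (isSmithForm_iff e A φ).1 hφ
  obtain ⟨k₁, k₂, k₃⟩ := (isSmithForm_iff e A χ).1 hχ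
  funext i
  exact eq_of_monic_of_associated (h₁ i) (k₁ i) <| associated_of_dvd_dvd
    (dvd_of_unimodularEquivalent_diagonal h₂ k₂ (fun i => (h₁ i).ne_zero) (h₃.symm.trans k₃) i)
    (dvd_of_unimodularEquivalent_diagonal k₂ h₂ (fun i => (k₁ i).ne_zero) (k₃.symm.trans h₃) i)

/-! ### Existence of the Smith form -/

/-- An entry of least degree, among all nonzero entries of all matrices equivalent to `A`, divides
the whole matrix containing it, since otherwise a division with remainder would produce an entry of
smaller degree. -/
theorem exists_unimodularEquivalent_dvd {K ι : Type*} [Field K] [Fintype ι] [DecidableEq ι]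
    (A : Matrix ι ι K[X]) (hA : A ≠ 0) (i₀ : ι) :
    ∃ B : Matrix ι ι K[X], UnimodularEquivalent A B ∧ B i₀ i₀ ≠ 0 ∧ ∀ i j, B i₀ i₀ ∣ B i j := by
  classical
  have hex : ∃ d, ∃ B : Matrix ι ι K[X], UnimodularEquivalent A B ∧
      ∃ i j, B i j ≠ 0 ∧ (B i j).natDegree = d := by
    obtain ⟨i, j, hij⟩ : ∃ i j, A i j ≠ 0 := by
      by_contra! h
      exact hA (Matrix.ext h)
    exact ⟨_, A, .refl A, i, j, hij, rfl⟩
  obtain ⟨B₀, hB₀, i, j, hij, hd⟩ := Nat.find_spec hex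
  have hmin : ∀ B : Matrix ι ι K[X], UnimodularEquivalent A B → ∀ a b, B a b ≠ 0 →
      (B₀ i j).natDegree ≤ (B a b).natDegree := fun B hB a b hab =>
    hd ▸ Nat.find_min' hex ⟨B, hB, a, b, hab, rfl⟩
  set d := B₀ i j with hd_def
  -- A remainder modulo `d` occurring as an entry has smaller degree than `d`, hence vanishes.
  have hmod : ∀ B : Matrix ι ι K[X], UnimodularEquivalent A B → ∀ a b f, B a b = f % d →
      d ∣ f := by
    intro B hB a b f hf
    rw [← EuclideanDomain.mod_eq_zero]
    by_contra hne
    have := hmin B hB a b (hf ▸ hne)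
    rw [hf] at this
    exact absurd (natDegree_lt_natDegree hne (degree_mod_lt f hij)) (not_lt.2 this)
  have hunit : ∀ (a b : ι) (c : K[X]), a ≠ b → IsUnit (Matrix.transvection a b c) := by
    intro a b c hab
    rw [Matrix.isUnit_iff_isUnit_det, Matrix.det_transvection_of_ne a b hab c]
    exact isUnit_one
  have hrem : ∀ f : K[X], f + -(f / d) * d = f % d := fun f => by
    have := EuclideanDomain.div_add_mod f d
    linear_combination -this
  have hrow : ∀ B : Matrix ι ι K[X], UnimodularEquivalent A B → B i₀ i₀ = d →
      ∀ b, d ∣ B i₀ b := by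
    intro B hB h₀ b
    obtain rfl | hb := eq_or_ne b i₀
    · rw [h₀]
    · refine hmod _ (hB.trans (.mul_right (hunit i₀ b (-(B i₀ b / d)) hb.symm))) i₀ b _ ?_
      rw [Matrix.mul_transvection_apply_same, h₀, hrem]
  have hcol : ∀ B : Matrix ι ι K[X], UnimodularEquivalent A B → B i₀ i₀ = d →
      ∀ a, d ∣ B a i₀ := by
    intro B hB h₀ a
    obtain rfl | ha := eq_or_ne a i₀
    · rw [h₀]
    · refine hmod _ (hB.trans (.mul_left (hunit a i₀ (-(B a i₀ / d)) ha))) a i₀ _ ?_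
      rw [Matrix.transvection_mul_apply_same, h₀, hrem]
  obtain ⟨B, hB, h₀⟩ : ∃ B : Matrix ι ι K[X], UnimodularEquivalent A B ∧ B i₀ i₀ = d :=
    ⟨_, hB₀.trans (.submatrix _ (Equiv.swap i₀ i) (Equiv.swap i₀ j)), by simp [hd_def]⟩
  refine ⟨B, hB, h₀ ▸ hij, fun a b => ?_⟩
  rw [h₀]
  obtain rfl | ha := eq_or_ne a i₀
  · exact hrow B hB h₀ b
  -- The entry `B a i₀` is cleared, and then row `a` is added to row `i₀`, which keeps the pivot.
  obtain ⟨q, hq⟩ := hcol B hB h₀ a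
  have hC := hrow (Matrix.transvection i₀ a 1 * (Matrix.transvection a i₀ (-q) * B))
    ((hB.trans (.mul_left (hunit a i₀ _ ha))).trans (.mul_left (hunit i₀ a _ ha.symm)))
    (by
      rw [Matrix.transvection_mul_apply_same, Matrix.transvection_mul_apply_same,
        Matrix.transvection_mul_apply_of_ne _ _ _ _ ha.symm, hq, h₀]
      ring) b
  rw [Matrix.transvection_mul_apply_same, Matrix.transvection_mul_apply_same,
    Matrix.transvection_mul_apply_of_ne _ _ _ _ ha.symm] at hC
  obtain ⟨s, hs⟩ := hrow B hB h₀ b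
  obtain ⟨t, ht⟩ := hC
  exact ⟨t - s + q * s, by linear_combination ht - (1 - q) * hs⟩

/-- A nonzero polynomial matrix is equivalent to `d • (1 ⊕ C)` with `d` monic. -/
theorem exists_unimodularEquivalent_smul_fromBlocks {K ι κ : Type*} [Field K] [Fintype ι]
    [DecidableEq ι] [Fintype κ] [DecidableEq κ] (A : Matrix ι ι K[X]) (hA : A ≠ 0)
    (e : Unit ⊕ κ ≃ ι) :
    ∃ (d : K[X]) (C : Matrix κ κ K[X]), d.Monic ∧
      UnimodularEquivalent A (d • Matrix.fromBlocks (1 : Matrix Unit Unit K[X]) 0 0 C) := by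
  obtain ⟨B, hB, h₀, hdvd⟩ := exists_unimodularEquivalent_dvd A hA (e (Sum.inl ()))
  set f := B (e (Sum.inl ())) (e (Sum.inl ())) with hf
  choose q hq using hdvd
  let Q : Matrix (Unit ⊕ κ) (Unit ⊕ κ) K[X] := fun a b => q (e a) (e b)
  have hBQ : B.submatrix e e = f • Q := by
    refine Matrix.ext fun a b => ?_
    simpa using hq (e a) (e b)
  have hQ : Q.toBlocks₁₁ = 1 := by
    refine Matrix.ext fun a b => ?_
    have : f * q (e (Sum.inl ())) (e (Sum.inl ())) = f * 1 := by rw [← hq, mul_one]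
    simpa [Matrix.toBlocks₁₁, Q] using mul_left_cancel₀ h₀ this
  have hQC : UnimodularEquivalent Q (Matrix.fromBlocks (1 : Matrix Unit Unit K[X]) 0 0
      (Q.toBlocks₂₂ - Q.toBlocks₂₁ * Q.toBlocks₁₂)) := by
    refine .of_isUnit (U := Matrix.fromBlocks 1 0 (-Q.toBlocks₂₁) 1)
      (V := Matrix.fromBlocks 1 (-Q.toBlocks₁₂) 0 1) (by simp) (by simp) ?_
    conv_lhs => rw [← Matrix.fromBlocks_toBlocks Q, hQ]
    simp [Matrix.fromBlocks_multiply, sub_eq_add_neg, add_comm]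
  have hc : f.leadingCoeff ≠ 0 := leadingCoeff_ne_zero.2 h₀
  refine ⟨C f.leadingCoeff⁻¹ * f, Q.toBlocks₂₂ - Q.toBlocks₂₁ * Q.toBlocks₁₂,
    monic_C_mul_of_mul_leadingCoeff_eq_one (by simp [hc]), ?_⟩
  refine ((hB.trans (.submatrix B e e)).trans (hBQ ▸ hQC.smul f)).trans
    (.of_isUnit (U := C f.leadingCoeff⁻¹ • 1) (V := 1) ?_ isUnit_one ?_)
  · rw [Matrix.isUnit_iff_isUnit_det, Matrix.det_smul, Matrix.det_one, mul_one]
    exact (isUnit_C.2 (by simp [hc])).pow _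
  · rw [Matrix.mul_one, Matrix.smul_mul, Matrix.one_mul, smul_smul]

/-- Existence of the Smith form. Splitting off `d • (1 ⊕ C)` leaves the factor `d` in all later
diagonal entries, so the divisibility chain is inherited from the Smith form of `C`. -/
theorem exists_unimodularEquivalent_diagonal {K : Type*} [Field K] {m : ℕ}
    (A : Matrix (Fin m) (Fin m) K[X]) (hA : A.det ≠ 0) :
    ∃ φ : Fin m → K[X], (∀ i, (φ i).Monic) ∧ (∀ i j, i ≤ j → φ i ∣ φ j) ∧
      UnimodularEquivalent A (Matrix.diagonal φ) := by
  induction m with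
  | zero =>
    exact ⟨Fin.elim0, fun i => i.elim0, fun i => i.elim0,
      Subsingleton.elim A (Matrix.diagonal Fin.elim0) ▸ .refl A⟩
  | succ m ih =>
    have hA₀ : A ≠ 0 := by rintro rfl; simp at hA
    let e : Unit ⊕ Fin m ≃ Fin (m + 1) :=
      (Equiv.sumComm _ _).trans ((Equiv.optionEquivSumPUnit _).symm.trans (finSuccEquiv m).symm)
    obtain ⟨d, C, hd, h⟩ := exists_unimodularEquivalent_smul_fromBlocks A hA₀ e
    have hC : C.det ≠ 0 := by
      intro hC
      obtain ⟨U, U', V, V', h₁, h₂, h₃, h₄, h₅⟩ :=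
        h.trans (.submatrix _ e.symm e.symm)
      have hdet := congrArg Matrix.det h₅
      rw [Matrix.det_submatrix_equiv_self, Matrix.det_smul, Matrix.det_fromBlocks_zero₂₁, hC,
        mul_zero, mul_zero, Matrix.det_mul, Matrix.det_mul] at hdet
      have hU : U.det ≠ 0 := fun h0 => by simpa [h0] using congrArg Matrix.det h₁
      have hV : V.det ≠ 0 := fun h0 => by simpa [h0] using congrArg Matrix.det h₃
      exact mul_ne_zero (mul_ne_zero hU hA) hV hdet
    obtain ⟨φ, h₁, h₂, h₃⟩ := ih C hC
    refine ⟨Fin.cons d fun i => d * φ i, ?_, ?_, ?_⟩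
    · exact Fin.cases hd fun i => hd.mul (h₁ i)
    · refine Fin.cases (Fin.cases ?_ fun j => ?_) fun i => Fin.cases ?_ fun j => ?_
      · simp
      · simp
      · simp
      · simpa using fun hij => mul_dvd_mul_left d (h₂ i j hij)
    · refine (h.trans (h₃.fromBlocks_one.smul d)).trans ?_
      convert UnimodularEquivalent.submatrix _ e.symm e.symm using 1
      rw [← Matrix.diagonal_one, Matrix.fromBlocks_diagonal, ← Matrix.diagonal_smul,
        Matrix.submatrix_diagonal_equiv]
      congr 1
      funext i
      refine Fin.cases ?_ (fun i => ?_) i <;> simp [e]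

/-! ### The Smith form of the linearization -/

theorem map_C_constantCoeff_add_X_smul_map_divX {ι κ : Type*} (N : Matrix ι κ ℂ[X]) :
    (N.map constantCoeff).map C + (X : ℂ[X]) • N.map divX = N := by
  refine Matrix.ext fun i j => ?_
  simpa [mul_comm X, add_comm] using divX_mul_X_add (N i j)

/-- `S` has Schur complement `P / X`; this is the identity behind it, without denominators. -/
theorem quadP_eq_X_smul_add {n r : ℕ} (M D : Matrix (Fin n) (Fin n) ℂ)
    (G : Matrix (Fin n) (Fin r) ℂ) :
    quadP M D G = (X : ℂ[X]) • ((X : ℂ[X]) • M.map C + D.map C) + G.map C * Gᴴ.map C := by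
  rw [quadP, Matrix.map_mul, smul_add, smul_smul, sq]

theorem map_constantCoeff_quadP {n r : ℕ} (M D : Matrix (Fin n) (Fin n) ℂ)
    (G : Matrix (Fin n) (Fin r) ℂ) : (quadP M D G).map constantCoeff = G * Gᴴ := by
  refine Matrix.ext fun i j => ?_
  simp [quadP, sq, Matrix.mul_apply]

/-- Elimination in a pencil whose blocks are diagonal up to an isometry `J`, whose range is spanned
by the unit vectors `eᵢ` with `(p i).coeff 0 ≠ 0`. -/
theorem unimodularEquivalent_fromBlocks_of_selection {n r : ℕ} {p φ : Fin n → ℂ[X]}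
    (hp : ∀ i, p i = if (p i).coeff 0 = 0 then X * φ i else φ i)
    {J : Matrix (Fin n) (Fin r) ℂ[X]} (hJ : Jᵀ * J = 1)
    (hJ' : J * Jᵀ = Matrix.diagonal fun i => if (p i).coeff 0 = 0 then 0 else 1) :
    UnimodularEquivalent
      (Matrix.fromBlocks (Matrix.diagonal fun i => divX (p i)) J
        (Jᵀ * Matrix.diagonal fun i => C ((p i).coeff 0)) (-((X : ℂ[X]) • 1)))
      (Matrix.fromBlocks (Matrix.diagonal φ) 0 0 (1 : Matrix (Fin r) (Fin r) ℂ[X])) := by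
  set B := Matrix.diagonal fun i => divX (p i) with hB
  -- This matrix is an involution: it identifies the second block with the range of `J` in the
  -- first, exchanges the two, and fixes the rest.
  have hW : IsUnit (Matrix.fromBlocks (1 - J * Jᵀ) J Jᵀ (0 : Matrix (Fin r) (Fin r) ℂ[X])) := by
    refine IsUnit.of_mul_eq_one (Matrix.fromBlocks (1 - J * Jᵀ) J Jᵀ 0) ?_
    rw [Matrix.fromBlocks_multiply, ← Matrix.fromBlocks_one]
    have h₁ : (1 - J * Jᵀ) * J = 0 := by
      rw [Matrix.sub_mul, Matrix.mul_assoc, hJ, Matrix.one_mul, Matrix.mul_one, sub_self]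
    have h₂ : Jᵀ * (1 - J * Jᵀ) = 0 := by
      rw [Matrix.mul_sub, ← Matrix.mul_assoc, hJ, Matrix.one_mul, Matrix.mul_one, sub_self]
    congr 1
    · rw [Matrix.mul_sub, ← Matrix.mul_assoc, h₁, Matrix.zero_mul, Matrix.mul_one]
      simp
    · simp [h₁]
    · simp [h₂]
    · simp [hJ]
  have hdiag : (X : ℂ[X]) • B + Matrix.diagonal (fun i => C ((p i).coeff 0)) =
      Matrix.diagonal p := by
    rw [hB, ← Matrix.diagonal_smul, Matrix.diagonal_add]
    congr 1
    funext i
    simpa [mul_comm X] using divX_mul_X_add (p i)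
  -- Adding `X • Jᵀ` times the first block row to the second clears the block `-X • 1`.
  have hrow : Matrix.fromBlocks 1 0 ((X : ℂ[X]) • Jᵀ) 1 *
      Matrix.fromBlocks B J (Jᵀ * Matrix.diagonal fun i => C ((p i).coeff 0))
        (-((X : ℂ[X]) • 1)) = Matrix.fromBlocks B J (Jᵀ * Matrix.diagonal p) 0 := by
    rw [Matrix.fromBlocks_multiply]
    congr 1
    · simp
    · simp
    · rw [← hdiag, Matrix.mul_add]; simp
    · simp [hJ]
  have hcol : Matrix.fromBlocks B J (Jᵀ * Matrix.diagonal p) 0 *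
      Matrix.fromBlocks 1 0 (-(Jᵀ * B)) 1 =
      Matrix.fromBlocks ((1 - J * Jᵀ) * B) J (Jᵀ * Matrix.diagonal p)
        (0 : Matrix (Fin r) (Fin r) ℂ[X]) := by
    rw [Matrix.fromBlocks_multiply]
    congr 1
    · rw [Matrix.sub_mul, Matrix.mul_one, Matrix.one_mul, Matrix.mul_neg, Matrix.mul_assoc,
        sub_eq_add_neg]
    · simp
    · simp
    · simp
  refine (UnimodularEquivalent.mul_left
    (U := Matrix.fromBlocks 1 0 ((X : ℂ[X]) • Jᵀ) 1) (by simp)).trans ?_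
  rw [hrow]
  refine (UnimodularEquivalent.mul_right
    (V := Matrix.fromBlocks 1 0 (-(Jᵀ * B)) 1) (by simp)).trans ?_
  rw [hcol]
  refine (UnimodularEquivalent.mul_left hW).trans ?_
  have hfinal : Matrix.fromBlocks (1 - J * Jᵀ) J Jᵀ (0 : Matrix (Fin r) (Fin r) ℂ[X]) *
      Matrix.fromBlocks ((1 - J * Jᵀ) * B) J (Jᵀ * Matrix.diagonal p) 0 =
      Matrix.fromBlocks (Matrix.diagonal φ) 0 0 1 := by
    rw [Matrix.fromBlocks_multiply]
    congr 1
    · rw [← Matrix.mul_assoc J, hJ', hB, ← Matrix.diagonal_one, Matrix.diagonal_sub]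
      simp only [Matrix.diagonal_mul_diagonal, Matrix.diagonal_add]
      congr 1
      funext i
      have := hp i
      split_ifs at this ⊢ with h
      · have hdiv : divX (p i) = φ i := by
          rw [this]
          ext k
          rw [coeff_divX, coeff_X_mul]
        simp [hdiv]
      · rw [this]; simp
    · simp [Matrix.sub_mul, Matrix.mul_assoc, hJ]
    · rw [Matrix.zero_mul, add_zero, ← Matrix.mul_assoc, Matrix.mul_sub, ← Matrix.mul_assoc, hJ]
      simp
    · simp [hJ]
  rw [hfinal]
  exact .refl _

/-- A factorization `U₀ G Gᴴ V₀ = diag c` with `G` of full column rank `r` splits: there are `r`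
nonzero `c i`, whose unit vectors form the columns of `J`, and `U₀ G = J E`, `Gᴴ V₀ = F Jᵀ`. This
rests on `W G Gᴴ = 0 ↔ W G = 0`. -/
theorem exists_selection_of_mul_mul_eq_diagonal {n r : ℕ} {G : Matrix (Fin n) (Fin r) ℂ}
    (hG : G.rank = r) {U₀ V₀ : Matrix (Fin n) (Fin n) ℂ} (hU₀ : IsUnit U₀) (hV₀ : IsUnit V₀)
    {c : Fin n → ℂ} (h₀ : U₀ * (G * Gᴴ) * V₀ = Matrix.diagonal c) :
    ∃ (J : Matrix (Fin n) (Fin r) ℂ) (E F : Matrix (Fin r) (Fin r) ℂ), Jᵀ * J = 1 ∧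
      J * Jᵀ = Matrix.diagonal (fun i => if c i = 0 then 0 else 1) ∧ IsUnit E ∧
      U₀ * G = J * E ∧ Gᴴ * V₀ = F * Jᵀ ∧ J * E * (F * Jᵀ) = Matrix.diagonal c ∧
      E * (F * Jᵀ) = Jᵀ * Matrix.diagonal c := by
  have hcard : Fintype.card (Fin r) = Fintype.card {i // c i ≠ 0} := by
    rw [← Matrix.rank_diagonal, ← h₀,
      Matrix.rank_mul_eq_left_of_isUnit_det _ _ ((Matrix.isUnit_iff_isUnit_det _).1 hV₀),
      Matrix.rank_mul_eq_right_of_isUnit_det _ _ ((Matrix.isUnit_iff_isUnit_det _).1 hU₀),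
      Matrix.rank_self_mul_conjTranspose, hG, Fintype.card_fin]
  let f : Fin r ≃ {i // c i ≠ 0} := Fintype.equivOfCardEq hcard
  let J : Matrix (Fin n) (Fin r) ℂ := (1 : Matrix (Fin n) (Fin n) ℂ).submatrix id fun k => f k
  have hJ : Jᵀ * J = 1 := by
    ext i j
    simp [J, Matrix.mul_apply, Matrix.one_apply, Subtype.val_inj, eq_comm]
  -- `J * Jᵀ` is the orthogonal projection onto the span of the selected unit vectors.
  have hJ' : J * Jᵀ = Matrix.diagonal fun i => if c i = 0 then 0 else 1 := by
    ext i j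
    rw [Matrix.mul_apply, Matrix.diagonal_apply,
      ← f.symm.sum_comp fun k => J i k * Jᵀ k j]
    simp only [J, Matrix.transpose_apply, Matrix.submatrix_apply, id, Matrix.one_apply,
      Equiv.apply_symm_apply]
    by_cases hi : c i = 0
    · rw [Finset.sum_eq_zero]
      · simp [hi]
      · rintro ⟨k, hk⟩ -
        rw [if_neg, zero_mul]
        rintro rfl
        exact hk hi
    · rw [Finset.sum_eq_single ⟨i, hi⟩]
      · simp [hi, eq_comm]
      · rintro ⟨k, hk⟩ - hne
        rw [if_neg, zero_mul]
        rintro rfl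
        exact hne rfl
      · simp
  have hJc : J * Jᵀ * Matrix.diagonal c = Matrix.diagonal c := by
    rw [hJ', Matrix.diagonal_mul_diagonal]
    congr 1
    funext i
    by_cases hi : c i = 0 <;> simp [hi]
  have hcJ : Matrix.diagonal c * (J * Jᵀ) = Matrix.diagonal c := by
    rw [hJ', Matrix.diagonal_mul_diagonal]
    congr 1
    funext i
    by_cases hi : c i = 0 <;> simp [hi]
  set E : Matrix (Fin r) (Fin r) ℂ := Jᵀ * (U₀ * G) with hE_def
  set F : Matrix (Fin r) (Fin r) ℂ := Gᴴ * V₀ * J with hF_def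
  have hE : U₀ * G = J * E := by
    have : (1 - J * Jᵀ) * U₀ * (G * Gᴴ) = 0 := by
      refine hV₀.mul_left_injective ?_
      calc (1 - J * Jᵀ) * U₀ * (G * Gᴴ) * V₀ = (1 - J * Jᵀ) * (U₀ * (G * Gᴴ) * V₀) := by
            simp only [Matrix.mul_assoc]
        _ = 0 * V₀ := by rw [h₀, Matrix.sub_mul, hJc, Matrix.one_mul, sub_self, Matrix.zero_mul]
    rw [Matrix.mul_self_mul_conjTranspose_eq_zero, Matrix.mul_assoc, Matrix.sub_mul,
      Matrix.one_mul, sub_eq_zero] at this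
    rw [this, Matrix.mul_assoc J]
  have hF : Gᴴ * V₀ = F * Jᵀ := by
    have : G * Gᴴ * (V₀ * (1 - J * Jᵀ)) = 0 := by
      refine hU₀.mul_right_injective ?_
      calc U₀ * (G * Gᴴ * (V₀ * (1 - J * Jᵀ))) = (U₀ * (G * Gᴴ) * V₀) * (1 - J * Jᵀ) := by
            simp only [Matrix.mul_assoc]
        _ = U₀ * 0 := by rw [h₀, Matrix.mul_sub, hcJ, Matrix.mul_one, sub_self, Matrix.mul_zero]
    rw [Matrix.self_mul_conjTranspose_mul_eq_zero, ← Matrix.mul_assoc, Matrix.mul_sub,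
      Matrix.mul_one, sub_eq_zero] at this
    rw [this, Matrix.mul_assoc _ J]
  have hEF : E * F = Jᵀ * Matrix.diagonal c * J := by
    rw [← h₀, hE_def, hF_def]
    simp only [Matrix.mul_assoc]
  clear_value E F
  have hEFJ : E * (F * Jᵀ) = Jᵀ * Matrix.diagonal c := by
    rw [← Matrix.mul_assoc, hEF, Matrix.mul_assoc, Matrix.mul_assoc, hcJ]
  have hE_unit : IsUnit E := by
    have hdiag : E * F = Matrix.diagonal fun k => c (f k) := by
      rw [hEF]
      ext i j
      rw [Matrix.mul_assoc, Matrix.mul_apply, Matrix.diagonal_apply]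
      simp [J, Matrix.one_apply, Subtype.val_inj, eq_comm]
      grind
    have hunit : IsUnit (E * F).det := by
      rw [hdiag, Matrix.det_diagonal, isUnit_iff_ne_zero]
      exact Finset.prod_ne_zero_iff.2 fun k _ => (f k).2
    rw [Matrix.det_mul] at hunit
    exact (Matrix.isUnit_iff_isUnit_det _).2 (isUnit_of_mul_isUnit_left hunit)
  exact ⟨J, E, F, hJ, hJ', hE_unit, hE, hF,
    by rw [Matrix.mul_assoc, hEFJ, ← Matrix.mul_assoc, hJc], hEFJ⟩

/-- If `P` is equivalent to `diag p`, then `S` is equivalent to `diag φ ⊕ 1`, where `φ i` arises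
from `p i` by removing a factor `X` if there is one.

Let `U * P * V = diag p`. At zero, `U(0) G Gᴴ V(0) = diag c` with `c i = p i (0)`, so that `r` of
the `c i` are nonzero and `U(0) G = J E` and `Gᴴ V(0) = F Jᵀ`, where the columns of `J` are the
corresponding unit vectors and `E`, `F` are invertible. The deviations `U G - J E` and
`Gᴴ V - F Jᵀ` are multiples of `X` and can be removed with the block `-X • 1` of the pencil, which
turns the leading block into `(diag p - diag c) / X`. -/
theorem pencilS_unimodularEquivalent {n r : ℕ} (M D : Matrix (Fin n) (Fin n) ℂ)
    (G : Matrix (Fin n) (Fin r) ℂ) (hG : G.rank = r) {p φ : Fin n → ℂ[X]}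
    (h : UnimodularEquivalent (quadP M D G) (Matrix.diagonal p))
    (hp : ∀ i, p i = if (p i).coeff 0 = 0 then X * φ i else φ i) :
    UnimodularEquivalent (pencilS M D G)
      (Matrix.fromBlocks (Matrix.diagonal φ) 0 0 (1 : Matrix (Fin r) (Fin r) ℂ[X])) := by
  obtain ⟨U, V, hU, hV, hUV⟩ := h.exists_isUnit
  set U₀ := U.map constantCoeff with hU₀_def
  set V₀ := V.map constantCoeff with hV₀_def
  set c : Fin n → ℂ := fun i => (p i).coeff 0 with hc_def
  have hU₀ : IsUnit U₀ := hU.map (constantCoeff (R := ℂ)).mapMatrix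
  have hV₀ : IsUnit V₀ := hV.map (constantCoeff (R := ℂ)).mapMatrix
  have h₀ : U₀ * (G * Gᴴ) * V₀ = Matrix.diagonal c := by
    rw [← map_constantCoeff_quadP M D G, hU₀_def, hV₀_def, ← Matrix.map_mul, ← Matrix.map_mul, hUV,
      Matrix.diagonal_map (map_zero _)]
    rfl
  obtain ⟨J, E, F, hJ, hJ', hE_unit, hE, hF, hJEF, hEFJ⟩ :=
    exists_selection_of_mul_mul_eq_diagonal hG hU₀ hV₀ h₀
  have hEC : IsUnit (E.map C) := hE_unit.map (C (R := ℂ)).mapMatrix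
  -- `E'` is the inverse of `E`, which normalizes the upper right block `J E` to `J`.
  obtain ⟨E', hE'⟩ : ∃ E' : Matrix (Fin r) (Fin r) ℂ[X], E.map C * E' = 1 ∧ IsUnit E' := by
    obtain ⟨u, hu⟩ := hEC
    exact ⟨↑u⁻¹, by rw [← hu, Units.mul_inv], Units.isUnit _⟩
  set Y := (U * G.map C).map divX
  set Z := (Gᴴ.map C * V).map divX
  have hmapC : ∀ {k l : ℕ} (N : Matrix (Fin k) (Fin l) ℂ), (N.map C).map constantCoeff = N :=
    fun N => Matrix.ext fun i j => by simp
  have hY : (X : ℂ[X]) • Y = U * G.map C - J.map C * E.map C := by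
    have h₁ : (U * G.map C).map constantCoeff = J * E := by rw [Matrix.map_mul, hmapC, ← hE]
    rw [eq_sub_iff_add_eq', ← Matrix.map_mul, ← h₁]
    exact map_C_constantCoeff_add_X_smul_map_divX _
  have hZ : (X : ℂ[X]) • Z = Gᴴ.map C * V - F.map C * Jᵀ.map C := by
    have h₁ : (Gᴴ.map C * V).map constantCoeff = F * Jᵀ := by rw [Matrix.map_mul, hmapC, ← hF]
    rw [eq_sub_iff_add_eq', ← Matrix.map_mul, ← h₁]
    exact map_C_constantCoeff_add_X_smul_map_divX _
  have hCc : (Matrix.diagonal c).map C = Matrix.diagonal fun i => C (c i) := by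
    rw [Matrix.diagonal_map (map_zero _)]
  set A : Matrix (Fin n) (Fin n) ℂ[X] := (X : ℂ[X]) • M.map C + D.map C with hA_def
  -- The leading block left by the elimination; multiplied by `X`, it is `U P V - J E F Jᵀ`.
  have hB : U * A * V + Y * (Gᴴ.map C * V) + J.map C * E.map C * Z =
      Matrix.diagonal fun i => divX (p i) := by
    have hX : (X : ℂ[X]) • (U * A * V + Y * (Gᴴ.map C * V) + J.map C * E.map C * Z) =
        (X : ℂ[X]) • Matrix.diagonal fun i => divX (p i) := by
      calc _ = U * ((X : ℂ[X]) • A) * V + ((X : ℂ[X]) • Y) * (Gᴴ.map C * V) +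
              J.map C * E.map C * ((X : ℂ[X]) • Z) := by
            simp only [smul_add, Matrix.smul_mul, Matrix.mul_smul]
        _ = U * ((X : ℂ[X]) • A + G.map C * Gᴴ.map C) * V -
              J.map C * E.map C * (F.map C * Jᵀ.map C) := by
            rw [hY, hZ]
            simp only [Matrix.mul_add, Matrix.add_mul, Matrix.sub_mul, Matrix.mul_sub,
              Matrix.mul_assoc]
            abel
        _ = Matrix.diagonal p - Matrix.diagonal fun i => C (c i) := by
            rw [← quadP_eq_X_smul_add, hUV, ← hCc, ← hJEF]
            simp only [Matrix.map_mul]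
        _ = _ := by
            rw [Matrix.diagonal_sub, ← Matrix.diagonal_smul]
            congr 1
            funext i
            have := divX_mul_X_add (p i)
            simp only [Pi.smul_apply, smul_eq_mul, hc_def]
            linear_combination -this
    refine Matrix.ext fun i j => mul_left_cancel₀ X_ne_zero ?_
    simpa using congrFun (congrFun hX i) j
  have hstep : Matrix.fromBlocks U Y 0 (E.map C) * pencilS M D G * Matrix.fromBlocks V 0 Z E' =
      Matrix.fromBlocks (Matrix.diagonal fun i => divX (p i)) (J.map C)
        ((J.map C)ᵀ * Matrix.diagonal fun i => C ((p i).coeff 0)) (-((X : ℂ[X]) • 1)) := by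
    have htop : U * G.map C + Y * -((X : ℂ[X]) • (1 : Matrix (Fin r) (Fin r) ℂ[X])) =
        J.map C * E.map C := by
      rw [Matrix.mul_neg, Matrix.mul_smul, Matrix.mul_one, hY]
      abel
    rw [show pencilS M D G = Matrix.fromBlocks A (G.map C) (Gᴴ.map C) (-((X : ℂ[X]) • 1)) from rfl,
      Matrix.fromBlocks_multiply, Matrix.fromBlocks_multiply, htop]
    refine Matrix.fromBlocks_inj.2 ⟨?_, ?_, ?_, ?_⟩
    · rw [← hB]
      simp only [Matrix.add_mul, Matrix.mul_assoc]
    · rw [Matrix.mul_zero, zero_add, Matrix.mul_assoc, hE'.1, Matrix.mul_one]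
    · have : (J.map C)ᵀ * Matrix.diagonal (fun i => C (c i)) =
          E.map C * (F.map C * Jᵀ.map C) := by
        rw [← hCc, ← Matrix.map_mul, ← Matrix.map_mul, hEFJ, Matrix.map_mul, Matrix.transpose_map]
      rw [show (fun i => C ((p i).coeff 0)) = fun i => C (c i) from rfl, this]
      simp only [Matrix.zero_mul, zero_add, Matrix.mul_neg, Matrix.neg_mul, Matrix.mul_smul,
        Matrix.smul_mul, Matrix.mul_one]
      rw [Matrix.mul_assoc, ← Matrix.mul_smul, hZ, Matrix.mul_sub]
      abel
    · simp [hE'.1]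
  refine (UnimodularEquivalent.of_isUnit ?_ ?_ hstep).trans
    (unimodularEquivalent_fromBlocks_of_selection hp ?_ ?_)
  · rw [Matrix.isUnit_fromBlocks_zero₂₁]
    exact ⟨hU, hEC⟩
  · rw [Matrix.isUnit_fromBlocks_zero₁₂]
    exact ⟨hV, hE'.2⟩
  · rw [← Matrix.transpose_map, ← Matrix.map_mul, hJ]
    simp
  · rw [← Matrix.transpose_map, ← Matrix.map_mul, hJ', Matrix.diagonal_map (map_zero _)]
    congr 1
    funext i
    simp only [hc_def]
    split_ifs <;> simp

theorem isSmithForm_pencilS {n r : ℕ} {M D : Matrix (Fin n) (Fin n) ℂ}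
    {G : Matrix (Fin n) (Fin r) ℂ} (hG : G.rank = r) {p φ : Fin n → ℂ[X]}
    (h : UnimodularEquivalent (quadP M D G) (Matrix.diagonal p))
    (hp : ∀ i, p i = if (p i).coeff 0 = 0 then X * φ i else φ i)
    (hφ : ∀ i, (φ i).Monic) (hφ' : ∀ i j, i ≤ j → φ i ∣ φ j) :
    IsSmithForm (pencilS M D G) (Fin.append (fun _ : Fin r => (1 : ℂ[X])) φ) := by
  let e : Fin n ⊕ Fin r ≃ Fin (r + n) := (Equiv.sumComm _ _).trans finSumFinEquiv
  rw [isSmithForm_iff e]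
  refine ⟨fun i => ?_, fun i j hij => ?_, ?_⟩
  · induction i using Fin.addCases with
    | left i => simp [monic_one]
    | right i => simpa using hφ i
  · induction i using Fin.addCases with
    | left i => simp
    | right i =>
      induction j using Fin.addCases with
      | left j =>
        have hij' := Fin.le_def.1 hij
        simp only [Fin.val_natAdd, Fin.val_castAdd] at hij'
        omega
      | right j => simpa using hφ' i j (by simpa using hij)
  · refine (pencilS_unimodularEquivalent M D G hG h hp).trans ?_
    convert UnimodularEquivalent.submatrix _ e.symm e.symm using 1
    rw [← Matrix.diagonal_one, Matrix.fromBlocks_diagonal, Matrix.submatrix_diagonal_equiv]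
    congr 1
    funext i
    refine Fin.addCases (fun i => ?_) (fun i => ?_) i <;> simp [e]

/-! ### The Smith–McMillan form -/

/-- The Smith–McMillan form of `T = P / X` determines a diagonal form of `P`. By coprimality each
`ψ i` divides `X`, so it is `1` or `X`, and which of the two is decided by whether `X` divides the
corresponding diagonal entry of `P`. -/
theorem IsSmithMcMillanForm.exists_unimodularEquivalent_quadP {n r : ℕ}
    {M D : Matrix (Fin n) (Fin n) ℂ} {G : Matrix (Fin n) (Fin r) ℂ} {φ ψ : Fin n → ℂ[X]}
    (h : IsSmithMcMillanForm (ratT M D G) φ ψ) :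
    ∃ p : Fin n → ℂ[X], UnimodularEquivalent (quadP M D G) (Matrix.diagonal p) ∧
      ∀ i, p i = if (p i).coeff 0 = 0 then X * φ i else φ i := by
  obtain ⟨-, hψ, hco, -, -, U, V, hU, hV, h⟩ := h
  set N := U * quadP M D G * V with hN
  have hX : (RatFunc.X : RatFunc ℂ) ≠ 0 := RatFunc.X_ne_zero
  have hinj := IsFractionRing.injective ℂ[X] (RatFunc ℂ)
  have hentry : ∀ i j, algebraMap ℂ[X] (RatFunc ℂ) (N i j) = RatFunc.X *
      Matrix.diagonal (fun i => algebraMap ℂ[X] (RatFunc ℂ) (φ i) /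
        algebraMap ℂ[X] (RatFunc ℂ) (ψ i)) i j := by
    intro i j
    rw [← h, ratT, Matrix.mul_smul, Matrix.smul_mul, ← Matrix.map_mul, ← Matrix.map_mul,
      Matrix.smul_apply, smul_eq_mul, mul_inv_cancel_left₀ hX, Matrix.map_apply]
  refine ⟨fun i => N i i, .of_isUnit hU hV ?_, fun i => ?_⟩
  · refine Matrix.ext fun i j => ?_
    obtain rfl | hij := eq_or_ne i j
    · simp [hN]
    · rw [Matrix.diagonal_apply_ne _ hij]
      refine hinj ?_
      rw [← hN, hentry, Matrix.diagonal_apply_ne _ hij, mul_zero, map_zero]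
  · have hmul : N i i * ψ i = X * φ i := by
      refine hinj ?_
      have hψ₀ : algebraMap ℂ[X] (RatFunc ℂ) (ψ i) ≠ 0 :=
        (map_ne_zero_iff _ hinj).2 (hψ i).ne_zero
      rw [map_mul, map_mul, hentry, Matrix.diagonal_apply_eq, RatFunc.algebraMap_X]
      field_simp
    have hdvd : ψ i ∣ X := (hco i).symm.dvd_of_dvd_mul_right ⟨N i i, by rw [← hmul, mul_comm]⟩
    obtain hu | ha := irreducible_X.dvd_iff.1 hdvd
    · rw [(hψ i).eq_one_of_isUnit hu, mul_one] at hmul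
      simp only [hmul, coeff_X_mul_zero, if_true]
    · have hψX := eq_of_monic_of_associated monic_X (hψ i) ha
      rw [← hψX, mul_comm] at hmul
      have hφ := mul_left_cancel₀ X_ne_zero hmul
      simp only [hφ]
      rw [if_neg]
      intro h0
      have hcoi := hco i
      rw [← hψX] at hcoi
      exact irreducible_X.not_isUnit (hcoi.isUnit_of_dvd' (X_dvd_iff.2 h0) dvd_rfl)

/-- The polynomial `if p.coeff 0 = 0 then divX p else p` is `p` with one factor `X` removed, if
there is one. -/
theorem eq_ite_divX (p : ℂ[X]) :
    p = if p.coeff 0 = 0 then X * (if p.coeff 0 = 0 then divX p else p)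
      else if p.coeff 0 = 0 then divX p else p := by
  split_ifs with h
  · have := divX_mul_X_add p
    rw [h, C_0, add_zero, mul_comm] at this
    exact this.symm
  · rfl

theorem monic_ite_divX {p : ℂ[X]} (hp : p.Monic) :
    (if p.coeff 0 = 0 then divX p else p).Monic := by
  have := eq_ite_divX p
  split_ifs at this ⊢ with h
  · exact Monic.of_mul_monic_left monic_X (this ▸ hp)
  · exact hp

theorem ite_divX_dvd {p q : ℂ[X]} (hpq : p ∣ q) :
    (if p.coeff 0 = 0 then divX p else p) ∣ if q.coeff 0 = 0 then divX q else q := by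
  have h₁ := eq_ite_divX p
  have h₂ := eq_ite_divX q
  split_ifs at h₁ h₂ ⊢ with hp hq hq
  · rw [h₁, h₂] at hpq
    exact (mul_dvd_mul_iff_left X_ne_zero).1 hpq
  · exact absurd (X_dvd_iff.1 ((X_dvd_iff.2 hp).trans hpq)) hq
  · rw [h₂] at hpq
    refine IsCoprime.dvd_of_dvd_mul_left (IsCoprime.symm ?_) hpq
    exact (irreducible_X.coprime_iff_not_dvd).2 fun h => hp (X_dvd_iff.1 h)
  · exact hpq

/-- Reducing the fractions `p i / X` turns the Smith form of `P` into the Smith–McMillan form of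
`T = P / X`. -/
theorem isSmithMcMillanForm_ratT {n r : ℕ} {M D : Matrix (Fin n) (Fin n) ℂ}
    {G : Matrix (Fin n) (Fin r) ℂ} {p : Fin n → ℂ[X]}
    (h : UnimodularEquivalent (quadP M D G) (Matrix.diagonal p)) (hp : ∀ i, (p i).Monic)
    (hp' : ∀ i j, i ≤ j → p i ∣ p j) :
    IsSmithMcMillanForm (ratT M D G) (fun i => if (p i).coeff 0 = 0 then divX (p i) else p i)
      (fun i => if (p i).coeff 0 = 0 then 1 else X) := by
  obtain ⟨U, V, hU, hV, hUV⟩ := h.exists_isUnit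
  refine ⟨fun i => monic_ite_divX (hp i), fun i => ?_, fun i => ?_,
    fun i j hij => ite_divX_dvd (hp' i j hij), fun i j hij => ?_, U, V, hU, hV, ?_⟩
  · dsimp only
    split_ifs
    exacts [monic_one, monic_X]
  · dsimp only
    split_ifs with h
    · exact isCoprime_one_right
    · exact ((irreducible_X.coprime_iff_not_dvd).2 fun hX => h (X_dvd_iff.1 hX)).symm
  · dsimp only
    split_ifs with h₁ h₂ h₂
    · exact one_dvd _
    · exact one_dvd _
    · exact absurd (X_dvd_iff.1 ((X_dvd_iff.2 h₂).trans (hp' i j hij))) h₁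
    · exact dvd_rfl
  · rw [ratT, Matrix.mul_smul, Matrix.smul_mul, ← Matrix.map_mul, ← Matrix.map_mul, hUV,
      Matrix.diagonal_map (map_zero _), ← Matrix.diagonal_smul]
    congr 1
    funext i
    have hX : (RatFunc.X : RatFunc ℂ) ≠ 0 := RatFunc.X_ne_zero
    have := congrArg (algebraMap ℂ[X] (RatFunc ℂ)) (eq_ite_divX (p i))
    simp only [Pi.smul_apply, smul_eq_mul]
    split_ifs at this ⊢ with h
    · rw [this, map_mul, RatFunc.algebraMap_X, map_one, div_one, inv_mul_cancel_left₀ hX]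
    · rw [RatFunc.algebraMap_X, div_eq_inv_mul]

/-! ### Multiplicity indices -/

theorem IsSmithForm.isMultiplicityIndex_iff {ι : Type*} [Fintype ι] [DecidableEq ι] {m : ℕ}
    {A : Matrix ι ι ℂ[X]} {φ : Fin m → ℂ[X]} (h : IsSmithForm A φ) (μ : ℂ) (k : Fin m → ℕ) :
    IsMultiplicityIndex μ A k ↔ k = fun i => (φ i).rootMultiplicity μ := by
  constructor
  · rintro ⟨χ, hχ, hk⟩
    rw [h.unique hχ]
    exact funext hk
  · rintro rfl
    exact ⟨φ, h, fun _ => rfl⟩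

theorem rootMultiplicity_X_mul {μ : ℂ} (hμ : μ ≠ 0) (q : ℂ[X]) :
    (X * q).rootMultiplicity μ = q.rootMultiplicity μ := by
  obtain rfl | hq := eq_or_ne q 0
  · simp
  · rw [rootMultiplicity_mul (mul_ne_zero X_ne_zero hq), rootMultiplicity_eq_zero, zero_add]
    simpa using hμ

/-! ### Evaluation of the matrices, and their null spaces -/

theorem evalMatrix_quadP {n r : ℕ} (M D : Matrix (Fin n) (Fin n) ℂ)
    (G : Matrix (Fin n) (Fin r) ℂ) (z : ℂ) :
    evalMatrix (quadP M D G) z = z ^ 2 • M + z • D + G * Gᴴ := by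
  refine Matrix.ext fun i j => ?_
  simp [evalMatrix, quadP, Matrix.mul_apply, eval_finsetSum]
  ring

theorem evalMatrix_pencilS {n r : ℕ} (M D : Matrix (Fin n) (Fin n) ℂ)
    (G : Matrix (Fin n) (Fin r) ℂ) (z : ℂ) :
    evalMatrix (pencilS M D G) z = Matrix.fromBlocks (z • M + D) G Gᴴ (-(z • 1)) := by
  rw [evalMatrix, pencilS, Matrix.fromBlocks_map]
  refine Matrix.fromBlocks_inj.2 ⟨?_, ?_, ?_, ?_⟩ <;> refine Matrix.ext fun i j => ?_
  · simp
    ring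
  · simp
  · simp
  · by_cases hij : i = j <;> simp [hij]

theorem mem_polySpectrum_iff_nullSpace_ne_bot {ι : Type*} [Fintype ι] [DecidableEq ι]
    (A : Matrix ι ι ℂ[X]) (z : ℂ) :
    z ∈ polySpectrum A ↔ nullSpace (evalMatrix A z) ≠ ⊥ := by
  rw [polySpectrum, Set.mem_ofPred_eq, ← Matrix.exists_mulVec_eq_zero_iff, Submodule.ne_bot_iff]
  simp only [nullSpace, LinearMap.mem_ker, Matrix.mulVecLin_apply]
  exact exists_congr fun v => and_comm

/-- `P` is regular, since `P(1) = M + D + G Gᴴ` is positive definite. -/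
theorem det_quadP_ne_zero {n r : ℕ} {M D : Matrix (Fin n) (Fin n) ℂ}
    (G : Matrix (Fin n) (Fin r) ℂ) (hM : M.PosDef) (hD : D.PosSemidef) :
    (quadP M D G).det ≠ 0 := by
  intro h
  have hpos : (evalMatrix (quadP M D G) 1).PosDef := by
    rw [evalMatrix_quadP, one_pow, one_smul, one_smul]
    exact (hM.add_posSemidef hD).add_posSemidef (Matrix.posSemidef_self_mul_conjTranspose G)
  refine hpos.det_pos.ne' ?_
  have := congrArg (evalRingHom (1 : ℂ)) h
  rwa [RingHom.map_det, map_zero] at this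

theorem mem_nullSpace_pencilS_iff {n r : ℕ} (M D : Matrix (Fin n) (Fin n) ℂ)
    (G : Matrix (Fin n) (Fin r) ℂ) (z : ℂ) (w : Fin n ⊕ Fin r → ℂ) :
    w ∈ nullSpace (evalMatrix (pencilS M D G) z) ↔
      (z • M + D) *ᵥ (w ∘ Sum.inl) + G *ᵥ (w ∘ Sum.inr) = 0 ∧
        Gᴴ *ᵥ (w ∘ Sum.inl) = z • (w ∘ Sum.inr) := by
  rw [nullSpace, LinearMap.mem_ker, Matrix.mulVecLin_apply, evalMatrix_pencilS,
    Matrix.fromBlocks_mulVec, ← Sum.elim_zero_zero, Sum.elim_eq_iff, Matrix.neg_mulVec,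
    Matrix.smul_mulVec, Matrix.one_mulVec, add_neg_eq_zero]

theorem mem_nullSpace_quadP_iff {n r : ℕ} (M D : Matrix (Fin n) (Fin n) ℂ)
    (G : Matrix (Fin n) (Fin r) ℂ) (z : ℂ) (u : Fin n → ℂ) :
    u ∈ nullSpace (evalMatrix (quadP M D G) z) ↔
      (z • M + D) *ᵥ (z • u) + G *ᵥ (Gᴴ *ᵥ u) = 0 := by
  rw [nullSpace, LinearMap.mem_ker, Matrix.mulVecLin_apply, evalMatrix_quadP, Matrix.mulVec_smul,
    Matrix.mulVec_mulVec, ← Matrix.smul_mulVec, ← Matrix.add_mulVec, smul_add, smul_smul, sq]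

theorem exists_nullSpace_linearEquiv {n r : ℕ} (M D : Matrix (Fin n) (Fin n) ℂ)
    (G : Matrix (Fin n) (Fin r) ℂ) {z : ℂ} (hz : z ≠ 0) :
    ∃ e : nullSpace (evalMatrix (quadP M D G) z) ≃ₗ[ℂ] nullSpace (evalMatrix (pencilS M D G) z),
      ∀ u : nullSpace (evalMatrix (quadP M D G) z),
        (e u : Fin n ⊕ Fin r → ℂ) =
          Sum.elim (z • (u : Fin n → ℂ)) (Gᴴ *ᵥ (u : Fin n → ℂ)) := by
  let L : (Fin n → ℂ) →ₗ[ℂ] (Fin n ⊕ Fin r → ℂ) :=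
    { toFun := fun u => Sum.elim (z • u) (Gᴴ *ᵥ u)
      map_add' := fun u v => by
        rw [smul_add, Matrix.mulVec_add]
        ext (i | i) <;> rfl
      map_smul' := fun a u => by
        rw [Matrix.mulVec_smul, smul_comm]
        ext (i | i) <;> rfl }
  have hL : ∀ u ∈ nullSpace (evalMatrix (quadP M D G) z),
      L u ∈ nullSpace (evalMatrix (pencilS M D G) z) := fun u hu =>
    (mem_nullSpace_pencilS_iff M D G z _).2
      ⟨(mem_nullSpace_quadP_iff M D G z u).1 hu, Matrix.mulVec_smul _ _ _⟩
  refine ⟨LinearEquiv.ofBijective (L.restrict hL) ⟨fun u v huv => ?_, fun w => ?_⟩, fun u => rfl⟩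
  · have h : (fun i => L u (Sum.inl i)) = fun i => L v (Sum.inl i) :=
      congrArg (fun w : nullSpace (evalMatrix (pencilS M D G) z) => fun i => w.1 (Sum.inl i)) huv
    exact Subtype.ext (smul_right_injective _ hz h)
  · obtain ⟨h₁, h₂⟩ := (mem_nullSpace_pencilS_iff M D G z w).1 w.2
    have hw₁ : z • z⁻¹ • (w.1 ∘ Sum.inl) = w.1 ∘ Sum.inl := smul_inv_smul₀ hz _
    have hw₂ : Gᴴ *ᵥ (z⁻¹ • (w.1 ∘ Sum.inl)) = w.1 ∘ Sum.inr := by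
      rw [Matrix.mulVec_smul, h₂, inv_smul_smul₀ hz]
    refine ⟨⟨z⁻¹ • (w.1 ∘ Sum.inl), ?_⟩, Subtype.ext ?_⟩
    · rw [mem_nullSpace_quadP_iff, hw₁, hw₂, h₁]
    · change Sum.elim (z • z⁻¹ • (w.1 ∘ Sum.inl)) (Gᴴ *ᵥ (z⁻¹ • (w.1 ∘ Sum.inl))) = w.1
      rw [hw₁, hw₂, Sum.elim_comp_inl_inr]

theorem polySpectrum_pencilS_diff_zero {n r : ℕ} (M D : Matrix (Fin n) (Fin n) ℂ)
    (G : Matrix (Fin n) (Fin r) ℂ) :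
    polySpectrum (pencilS M D G) \ {0} = polySpectrum (quadP M D G) \ {0} := by
  ext z
  refine and_congr_left fun hz => ?_
  obtain ⟨e, -⟩ := exists_nullSpace_linearEquiv M D G hz
  rw [mem_polySpectrum_iff_nullSpace_ne_bot, mem_polySpectrum_iff_nullSpace_ne_bot,
    ← Submodule.nontrivial_iff_ne_bot, ← Submodule.nontrivial_iff_ne_bot]
  exact e.toEquiv.nontrivial_congr.symm

/-- At zero the determinant of the pencil is `det D * det (-Gᴴ D⁻¹ G)`. -/
theorem zero_mem_polySpectrum_pencilS_iff {n r : ℕ} (M : Matrix (Fin n) (Fin n) ℂ)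
    {D : Matrix (Fin n) (Fin n) ℂ} (G : Matrix (Fin n) (Fin r) ℂ) (hD : IsUnit D) :
    0 ∈ polySpectrum (pencilS M D G) ↔ ¬ IsUnit (Gᴴ * D⁻¹ * G) := by
  have hdet := (Matrix.isUnit_iff_isUnit_det D).1 hD
  let := D.invertibleOfIsUnitDet hdet
  rw [polySpectrum, Set.mem_ofPred_eq, evalMatrix_pencilS, zero_smul, zero_smul, zero_add, neg_zero,
    Matrix.det_fromBlocks₁₁, zero_sub, Matrix.det_neg, Matrix.invOf_eq_nonsing_inv,
    Matrix.isUnit_iff_isUnit_det, isUnit_iff_ne_zero, not_not]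
  simp [hdet.ne_zero]

theorem zero_notMem_polySpectrum_pencilS {n r : ℕ} (M : Matrix (Fin n) (Fin n) ℂ)
    {D : Matrix (Fin n) (Fin n) ℂ} {G : Matrix (Fin n) (Fin r) ℂ} (hD : D.PosDef)
    (hG : G.rank = r) : 0 ∉ polySpectrum (pencilS M D G) := by
  rw [zero_mem_polySpectrum_pencilS_iff M G hD.isUnit, not_not]
  have hinj : Function.Injective G.mulVec := by
    rw [Matrix.mulVec_injective_iff, linearIndependent_iff_card_eq_finrank_span,
      Set.finrank, ← Matrix.rank_eq_finrank_span_cols, hG, Fintype.card_fin]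
  exact (hD.inv.conjTranspose_mul_mul_same hinj).isUnit

/-! ### Spectra, Smith forms and null spaces of the linearization -/

theorem mainTheorem2 {n r : ℕ} (M D : Matrix (Fin n) (Fin n) ℂ) (G : Matrix (Fin n) (Fin r) ℂ)
    (hM : M.PosDef) (hD : D.PosSemidef) (hG : G.rank = r) :
    -- the Smith form of `S` in terms of the Smith–McMillan form of `T = P / λ`
    ((∃ φ ψ : Fin n → ℂ[X], IsSmithMcMillanForm (ratT M D G) φ ψ) ∧
      ∀ φ ψ : Fin n → ℂ[X], IsSmithMcMillanForm (ratT M D G) φ ψ →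
        ∀ χ : Fin (r + n) → ℂ[X],
          IsSmithForm (pencilS M D G) χ ↔ χ = Fin.append (fun _ : Fin r => (1 : ℂ[X])) φ) ∧
    -- nonzero eigenvalues
    polySpectrum (pencilS M D G) \ {0} = polySpectrum (quadP M D G) \ {0} ∧
    -- multiplicity indices, that of `S` being padded with `r` leading zeros
    (∀ μ ∈ polySpectrum (quadP M D G) \ {0}, ∃ k : Fin n → ℕ,
      (∀ k' : Fin n → ℕ, IsMultiplicityIndex μ (quadP M D G) k' ↔ k' = k) ∧
      (∀ k' : Fin (r + n) → ℕ,
        IsMultiplicityIndex μ (pencilS M D G) k' ↔ k' = Fin.append (fun _ : Fin r => 0) k)) ∧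
    -- isomorphism of null spaces
    (∀ z : ℂ, z ≠ 0 →
      ∃ e : nullSpace (evalMatrix (quadP M D G) z) ≃ₗ[ℂ] nullSpace (evalMatrix (pencilS M D G) z),
        ∀ u : nullSpace (evalMatrix (quadP M D G) z),
          (e u : Fin n ⊕ Fin r → ℂ) =
            Sum.elim (z • (u : Fin n → ℂ)) (Gᴴ *ᵥ (u : Fin n → ℂ))) ∧
    -- the eigenvalue zero
    (IsUnit D → (0 ∈ polySpectrum (pencilS M D G) ↔ ¬ IsUnit (Gᴴ * D⁻¹ * G))) ∧
    (D.PosDef → polySpectrum (pencilS M D G) = polySpectrum (quadP M D G) \ {0}) := by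
  obtain ⟨p, hp, hp', hPp⟩ :=
    exists_unimodularEquivalent_diagonal _ (det_quadP_ne_zero G hM hD)
  refine ⟨⟨⟨_, _, isSmithMcMillanForm_ratT hPp hp hp'⟩, fun φ ψ h χ => ?_⟩,
    polySpectrum_pencilS_diff_zero M D G, fun μ hμ => ?_,
    fun z hz => exists_nullSpace_linearEquiv M D G hz,
    zero_mem_polySpectrum_pencilS_iff M G, fun hD' => ?_⟩
  · obtain ⟨q, hPq, hq⟩ := h.exists_unimodularEquivalent_quadP
    have hS := isSmithForm_pencilS hG hPq hq h.1 h.2.2.2.1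
    exact ⟨fun hχ => hχ.unique hS, fun hχ => hχ ▸ hS⟩
  · have hP : IsSmithForm (quadP M D G) p := (isSmithForm_iff (.refl _) _ _).2 ⟨hp, hp', hPp⟩
    have hS := isSmithForm_pencilS hG hPp (fun i => eq_ite_divX (p i))
      (fun i => monic_ite_divX (hp i)) fun i j hij => ite_divX_dvd (hp' i j hij)
    refine ⟨_, hP.isMultiplicityIndex_iff μ, fun k => ?_⟩
    rw [hS.isMultiplicityIndex_iff μ]
    refine Eq.congr_right (funext (Fin.addCases (fun i => ?_) fun i => ?_))
    · simp
    · have := congrArg (rootMultiplicity μ) (eq_ite_divX (p i))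
      simp only [Fin.append_right]
      rw [this]
      split_ifs
      · rw [rootMultiplicity_X_mul hμ.2]
      · rfl
  · rw [← polySpectrum_pencilS_diff_zero M D G,
      Set.sdiff_singleton_eq_self (zero_notMem_polySpectrum_pencilS M hD' hG)]
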